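/- Let $d\ge 1$, let $\Omega\subset\mathbb{R}^d$ be a bounded open set, and let $T>0$, $\gamma>0$, $0\neq u_0\in L_2(\Omega)$ and $f:(0,T)\to L_2(\Omega)$. Let $u$ be a weak solution of $$u_t-\Big(\int_\Omega u^2\,dx\Big)^{\gamma}\Delta u=f\ \text{ in }\Omega\times(0,T],\qquad u=0\ \text{ on }\partial\Omega\times(0,T],\qquad u(\cdot,0)=u_0,$$ that is, $u\in L_2(0,T;H_0^1(\Omega))$, the weak time derivative satisfies $u_t\in L_2(0,T;L_2(\Omega))$, for almost every $t\in(0,T)$ $$\int_\Omega u_t w\,dx+\Big(\int_\Omega u^2\,dx\Big)^{\gamma}\int_\Omega\nabla u\cdot\nabla w\,dx=\int_\Omega f w\,dx\qquad\text{for all } w\in H_0^1(\Omega),$$ and $u(\cdot,0)=u_0$, where $u$ denotes the representative in $C([0,T];L_2(\Omega))$. Let $C_2>0$ be a Poincaré constant of $\Omega$, that is, $$0<C_2\le\inf\Big\{\frac{\int_\Omega|\nabla v|^2\,dx}{\int_\Omega v^2\,dx}:\ v\in H_0^1(\Omega),\ v\ne0\Big\}$$ (in particular, $C_2$ may be the best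 Poincaré constant, i.e. this infimum). Suppose that $A\in\mathbb{R}$ satisfies $$A<C_2\Big(\int_\Omega u_0^2\,dx\Big)^{\frac{2\gamma+1}{2}},\qquad\text{and put}\qquad B=2\gamma C_2\Big(\int_\Omega u_0^2\,dx\Big)^{\gamma}-\frac{2\gamma A}{\big(\int_\Omega u_0^2\,dx\big)^{1/2}}.$$ If $$\|f(\cdot,t)\|_{L_2(\Omega)}\le\frac{A}{(1+Bt)^{\frac{2\gamma+1}{2\gamma}}}\qquad\text{for almost every }t\in(0,T),$$ then $$\int_\Omega u^2(x,t)\,dx\le\frac{\int_\Omega u_0^2\,dx}{(1+Bt)^{1/\gamma}}\qquad\text{for every }t\in[0,T].$$ -/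

import Mathlib

open MeasureTheory Set
open scoped ContDiff ENNReal

namespace NonlocalDecay

/-- Euclidean space `ℝ^d`. -/
abbrev Space (d : ℕ) : Type := EuclideanSpace ℝ (Fin d)

/-- The Hilbert space `L₂(Ω)` of real valued functions. -/
abbrev L2 {d : ℕ} (Ω : Set (Space d)) : Type := Lp ℝ 2 (volume.restrict Ω)

/-- The Hilbert space `L₂(Ω; ℝ^d)` of vector fields. -/
abbrev L2Field {d : ℕ} (Ω : Set (Space d)) : Type := Lp (Space d) 2 (volume.restrict Ω)

/-- `L₂(Ω) × L₂(Ω; ℝ^d)` with the Hilbert norm `(‖v‖² + ‖G‖²)^{1/2}`; on the pairs `(v, ∇v)` this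
is the norm of `H¹(Ω)`. -/
abbrev L2Pair {d : ℕ} (Ω : Set (Space d)) : Type := WithLp 2 (L2 Ω × L2Field Ω)

/-- `φ` is a test function: smooth with compact support contained in `Ω`. -/
structure IsTestFunction {V : Type*} [NormedAddCommGroup V] [NormedSpace ℝ V]
    (Ω : Set V) (φ : V → ℝ) : Prop where
  smooth : ContDiff ℝ ∞ φ
  compact : HasCompactSupport φ
  supp : tsupport φ ⊆ Ω

/-- `G` is the weak gradient of `v` in `Ω`: `∫_Ω v ∂_e φ = - ∫_Ω φ (G · e)` for all directions `e`
and all test functions `φ`. -/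
def HasWeakGradient {d : ℕ} (Ω : Set (Space d)) (v : L2 Ω) (G : L2Field Ω) : Prop :=
  ∀ (φ : Space d → ℝ), IsTestFunction Ω φ → ∀ e : Space d,
    ∫ x in Ω, v x * fderiv ℝ φ x e = -∫ x in Ω, φ x * inner ℝ (G x) e

/-- The subspace of all pairs `(φ, ∇φ)` with `φ ∈ C_c^∞(Ω)`. -/
def testGraph {d : ℕ} (Ω : Set (Space d)) : Submodule ℝ (L2Pair Ω) where
  carrier := {p | ∃ φ : Space d → ℝ, IsTestFunction Ω φ ∧
    p.fst =ᵐ[volume.restrict Ω] φ ∧ p.snd =ᵐ[volume.restrict Ω] gradient φ}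
  zero_mem' := by
    refine ⟨fun _ => 0, ⟨contDiff_const, HasCompactSupport.zero, ?_⟩, ?_, ?_⟩
    · simp [tsupport, Function.support]
    · exact Lp.coeFn_zero _ _ _
    · refine (Lp.coeFn_zero _ _ _).trans (Filter.Eventually.of_forall fun x => ?_)
      simp [gradient]
  add_mem' := by
    rintro p q ⟨φ, hφ, h1, h2⟩ ⟨ψ, hψ, h3, h4⟩
    refine ⟨φ + ψ, ⟨hφ.smooth.add hψ.smooth, hφ.compact.add hψ.compact, ?_⟩, ?_, ?_⟩
    · exact (tsupport_add φ ψ).trans (union_subset hφ.supp hψ.supp)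
    · exact (Lp.coeFn_add p.fst q.fst).trans (h1.add h3)
    · refine (Lp.coeFn_add p.snd q.snd).trans
        ((h2.add h4).trans (Filter.Eventually.of_forall fun x => ?_))
      have e1 := (hφ.smooth.differentiable (by simp)) x
      have e2 := (hψ.smooth.differentiable (by simp)) x
      simp [gradient, fderiv_add e1 e2]
  smul_mem' := by
    rintro c p ⟨φ, hφ, h1, h2⟩
    refine ⟨c • φ, ⟨contDiff_const.smul hφ.smooth, hφ.compact.smul_left (f := fun _ => c), ?_⟩,
      ?_, ?_⟩
    · exact (closure_mono (Function.support_const_smul_subset c φ)).trans hφ.supp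
    · exact (Lp.coeFn_smul c p.fst).trans (h1.const_smul c)
    · refine (Lp.coeFn_smul c p.snd).trans
        ((h2.const_smul c).trans (Filter.Eventually.of_forall fun x => ?_))
      have e1 := (hφ.smooth.differentiable (by simp)) x
      simp [gradient, fderiv_const_smul e1 c]

/-- The Sobolev space `H¹₀(Ω)`: the closure of `C_c^∞(Ω)` in the `H¹` norm. An element is
represented by the pair of the function and its weak gradient. -/
noncomputable def H10 {d : ℕ} (Ω : Set (Space d)) : Submodule ℝ (L2Pair Ω) := (testGraph Ω).topologicalClosure

/-- The function underlying an element of `H¹₀(Ω)`. -/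
noncomputable def H10.val {d : ℕ} {Ω : Set (Space d)} (w : H10 Ω) : L2 Ω := (w : L2Pair Ω).fst

/-- The weak gradient of an element of `H¹₀(Ω)`. -/
noncomputable def H10.grad {d : ℕ} {Ω : Set (Space d)} (w : H10 Ω) : L2Field Ω := (w : L2Pair Ω).snd

/-- The second component of an element of `H¹₀(Ω)` is indeed its weak gradient. -/
theorem H10.hasWeakGradient {d : ℕ} {Ω : Set (Space d)} (w : H10 Ω) :
    HasWeakGradient Ω (H10.val w) (H10.grad w) := by
  intro φ hφ e
  have hcd : Continuous (fun x => fderiv ℝ φ x e) :=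
    (hφ.smooth.continuous_fderiv (by simp)).clm_apply continuous_const
  have hsd : HasCompactSupport (fun x => fderiv ℝ φ x e) := hφ.compact.fderiv_apply (𝕜 := ℝ) e
  have m1 : MemLp (fun x => fderiv ℝ φ x e) 2 (volume.restrict Ω) :=
    (hcd.memLp_of_hasCompactSupport hsd).restrict Ω
  have m2 : MemLp (fun x => φ x • e) 2 (volume.restrict Ω) :=
    ((hφ.smooth.continuous.smul continuous_const).memLp_of_hasCompactSupport
      (hφ.compact.smul_right (f' := fun _ => e))).restrict Ω
  have key : ∀ p : L2Pair Ω,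
      (inner ℝ (m1.toLp _) p.fst = ∫ x in Ω, p.fst x * fderiv ℝ φ x e) ∧
      (inner ℝ (m2.toLp _) p.snd = ∫ x in Ω, φ x * inner ℝ (p.snd x) e) := by
    intro p
    constructor
    · rw [L2.inner_def]
      refine integral_congr_ae ?_
      filter_upwards [m1.coeFn_toLp] with x hx
      rw [hx]; simp
    · rw [L2.inner_def]
      refine integral_congr_ae ?_
      filter_upwards [m2.coeFn_toLp] with x hx
      rw [hx, inner_smul_left, real_inner_comm]; simp
  have hcl : IsClosed {p : L2Pair Ω |
      (inner ℝ (m1.toLp _) p.fst : ℝ) = -inner ℝ (m2.toLp _) p.snd} := by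
    refine isClosed_eq ?_ ?_
    · exact continuous_const.inner (WithLp.prod_continuous_ofLp 2 _ _).fst
    · exact (continuous_const.inner (WithLp.prod_continuous_ofLp 2 _ _).snd).neg
  have hsub : (testGraph Ω : Set (L2Pair Ω)) ⊆ {p : L2Pair Ω |
      (inner ℝ (m1.toLp _) p.fst : ℝ) = -inner ℝ (m2.toLp _) p.snd} := by
    rintro p ⟨ψ, hψ, h1, h2⟩
    rw [mem_ofPred_eq, (key p).1, (key p).2]
    have e1 : ∫ x in Ω, p.fst x * fderiv ℝ φ x e = ∫ x, ψ x * fderiv ℝ φ x e := by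
      rw [← setIntegral_eq_integral_of_forall_compl_eq_zero (s := Ω)
        (f := fun x => ψ x * fderiv ℝ φ x e)]
      · refine integral_congr_ae ?_
        filter_upwards [h1] with x hx
        rw [hx]
      · intro x hx
        rw [image_eq_zero_of_notMem_tsupport (fun h => hx (hψ.supp h)), zero_mul]
    have e2 : ∫ x in Ω, φ x * inner ℝ (p.snd x) e = ∫ x, fderiv ℝ ψ x e * φ x := by
      rw [← setIntegral_eq_integral_of_forall_compl_eq_zero (s := Ω)
        (f := fun x => fderiv ℝ ψ x e * φ x)]
      · refine integral_congr_ae ?_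
        filter_upwards [h2] with x hx
        rw [hx, gradient, InnerProductSpace.toDual_symm_apply, mul_comm]
      · intro x hx
        rw [image_eq_zero_of_notMem_tsupport (fun h => hx (hφ.supp h)), mul_zero]
    rw [e1, e2]
    have hcψ : Continuous (fun x => fderiv ℝ ψ x e) :=
      (hψ.smooth.continuous_fderiv (by simp)).clm_apply continuous_const
    refine integral_mul_fderiv_eq_neg_fderiv_mul_of_integrable ?_ ?_ ?_
      (fun x _ => hψ.smooth.differentiable (by simp) x)
      (fun x _ => hφ.smooth.differentiable (by simp) x)
    · exact (hcψ.mul hφ.smooth.continuous).integrable_of_hasCompactSupport hφ.compact.mul_left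
    · exact (hψ.smooth.continuous.mul hcd).integrable_of_hasCompactSupport hψ.compact.mul_right
    · exact (hψ.smooth.continuous.mul hφ.smooth.continuous).integrable_of_hasCompactSupport
        hψ.compact.mul_right
  have := closure_minimal hsub hcl w.2
  rw [mem_ofPred_eq, (key _).1, (key _).2] at this
  exact this

/-- The best constant `C` in the Poincaré inequality `C ∫_Ω v² ≤ ∫_Ω |∇v|²` on `H¹₀(Ω)`: the infimum
of the quotients `∫_Ω |∇v|² / ∫_Ω v²` over `v ∈ H¹₀(Ω)`, `v ≠ 0`. -/
noncomputable def poincareConstant {d : ℕ} (Ω : Set (Space d)) : ℝ :=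
  sInf {r : ℝ | ∃ v : H10 Ω, H10.val v ≠ 0 ∧
    r = (∫ x in Ω, ‖H10.grad v x‖ ^ 2) / ∫ x in Ω, (H10.val v x) ^ 2}

/-- `u'` is the weak (distributional) derivative on `]0,T[` of the `L₂(Ω)`-valued function `u`. -/
def HasWeakTimeDeriv {d : ℕ} {Ω : Set (Space d)} (T : ℝ) (u u' : ℝ → L2 Ω) : Prop :=
  ∀ φ : ℝ → ℝ, IsTestFunction (Ioo 0 T) φ →
    ∫ t in Ioo 0 T, deriv φ t • u t = -∫ t in Ioo 0 T, φ t • u' t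

/-- Weak solutions of `u_t - (∫_Ω u²)^γ Δu = f` in `Ω × ]0,T]`, `u = 0` on `∂Ω × ]0,T]`,
`u(·,0) = u₀`, for exponents `γ ≥ 0`: `u ∈ L₂(0,T;H¹₀(Ω))`, `u_t ∈ L₂(0,T;L₂(Ω))`, and
`∫_Ω u_t w + (∫_Ω u²)^γ ∫_Ω ∇u·∇w = ∫_Ω f w` for all `w ∈ H¹₀(Ω)` and almost all `t`.
As such a `u` agrees a.e. in time with a unique element of `C([0,T];L₂(Ω))`, the function `u` stands
for that representative, which gives a meaning to `u(·,0)` and to `u(·,t)` for every `t`. -/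
structure IsWeakSolution {d : ℕ} (Ω : Set (Space d)) (T γ : ℝ) (f : ℝ → L2 Ω) (u₀ : L2 Ω)
    (u : ℝ → L2 Ω) : Prop where
  continuousOn : ContinuousOn u (Icc 0 T)
  initial : u 0 = u₀
  equation : ∃ (U : ℝ → H10 Ω) (u' : ℝ → L2 Ω),
    MemLp U 2 (volume.restrict (Ioo 0 T)) ∧
    (∀ᵐ t ∂(volume.restrict (Ioo 0 T)), H10.val (U t) = u t) ∧
    MemLp u' 2 (volume.restrict (Ioo 0 T)) ∧
    HasWeakTimeDeriv T u u' ∧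
    ∀ᵐ t ∂(volume.restrict (Ioo 0 T)), ∀ w : H10 Ω,
      (∫ x in Ω, u' t x * H10.val w x)
        + (∫ x in Ω, (u t x) ^ 2) ^ γ * (∫ x in Ω, inner ℝ (H10.grad (U t) x) (H10.grad w x))
        = ∫ x in Ω, f t x * H10.val w x

end NonlocalDecay

/-! ### Absolutely continuous functions on an interval -/

section AbsolutelyContinuous

variable {X Y : Type*} [PseudoMetricSpace X] [PseudoMetricSpace Y]
  {F : Type*} [NormedAddCommGroup F] [NormedSpace ℝ F]

/-! Testing the equation with `u(t)` itself and using the Poincaré and Cauchy–Schwarz inequalities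
gives, for `y = ‖u‖²` and almost every `t`, `y' ≤ -2 C₂ y^(γ+1) + 2 ‖f‖ √y`. With `r = 1 + B t` and
`‖f‖` replaced by its bound, `y₀ / r^(1/γ)` solves the corresponding equation exactly; this is what
dictates `B`. The theorem is thus a comparison principle. Since `√y` is not Lipschitz at `0`, it is
proved directly: `ψ = y r^(1/γ)` starts at `y₀`, and `decay_rate_nonpos` shows `ψ' ≤ 0` almost
everywhere on `{ψ > y₀}`, so `ψ` can never rise above `y₀`.

The analytic input is that `y` is absolutely continuous with `y' = 2 (u, u_t)`. As `u_t` is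
integrable in time with values in `L₂(Ω)`, du Bois-Reymond's lemma makes `u` a primitive of `u_t`,
hence absolutely continuous and differentiable almost everywhere in `L₂(Ω)`. -/

open AbsolutelyContinuousOnInterval Filter in
theorem AbsolutelyContinuousOnInterval.of_dist_le {f : ℝ → X} {g : ℝ → Y} {a b : ℝ} (C : ℝ)
    (hg : AbsolutelyContinuousOnInterval g a b)
    (h : ∀ x ∈ uIcc a b, ∀ y ∈ uIcc a b, dist (f x) (f y) ≤ C * dist (g x) (g y)) :
    AbsolutelyContinuousOnInterval f a b := by
  unfold AbsolutelyContinuousOnInterval at hg ⊢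
  refine squeeze_zero' (Eventually.of_forall fun _ => Finset.sum_nonneg fun _ _ => dist_nonneg) ?_
    (by simpa using hg.const_mul C)
  rw [eventually_inf_principal]
  filter_upwards with E hE
  rw [Finset.mul_sum]
  exact Finset.sum_le_sum fun i hi => h _ (hE.1 i hi).1 _ (hE.1 i hi).2

/-- Increments of the primitive of `f` are dominated by those of the primitive of `‖f‖`, which
reduces the vector valued case to the scalar one. -/
theorem IntervalIntegrable.absolutelyContinuousOnInterval_integral {f : ℝ → F} {a b c : ℝ}
    (hf : IntervalIntegrable f volume a b) (hc : c ∈ uIcc a b) :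
    AbsolutelyContinuousOnInterval (fun x => ∫ t in c..x, f t) a b := by
  refine (hf.norm.absolutelyContinuousOnInterval_intervalIntegral hc).of_dist_le 1 ?_
  intro x hx y hy
  have hi : ∀ z ∈ uIcc a b, IntervalIntegrable f volume c z := fun z hz =>
    hf.mono_set (uIcc_subset_uIcc hc hz)
  rw [one_mul, dist_eq_norm, Real.dist_eq,
    intervalIntegral.integral_interval_sub_left (hi x hx) (hi y hy),
    intervalIntegral.integral_interval_sub_left (hi x hx).norm (hi y hy).norm]
  exact intervalIntegral.norm_integral_le_abs_integral_norm

/-- The fundamental theorem of calculus for vector valued absolutely continuous functions. -/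
theorem AbsolutelyContinuousOnInterval.integral_eq_sub_of_ae_hasDerivAt [CompleteSpace F]
    {f f' : ℝ → F} {a b : ℝ} (hf : AbsolutelyContinuousOnInterval f a b)
    (hd : ∀ᵐ x, x ∈ uIcc a b → HasDerivAt f (f' x) x) (hi : IntervalIntegrable f' volume a b) :
    ∫ x in a..b, f' x = f b - f a := by
  -- The difference of `f` and the primitive of `f'` is absolutely continuous with derivative zero
  -- almost everywhere, hence constant.
  have hac := hf.sub (hi.absolutelyContinuousOnInterval_integral left_mem_uIcc)
  obtain ⟨C, hC⟩ := hac.const_of_ae_hasDerivAt_zero <| by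
    filter_upwards [hd, hi.ae_hasDerivAt_integral] with x h1 h2 hx
    simpa using (h1 hx).sub (h2 hx a left_mem_uIcc)
  have h1 := hC a left_mem_uIcc
  have h2 := hC b right_mem_uIcc
  simp only [Pi.sub_apply, intervalIntegral.integral_same, sub_zero] at h1 h2
  rw [h1, ← h2]
  abel

/-- An absolutely continuous function whose derivative is nonpositive wherever the function exceeds
a level stays below this level if it starts there. -/
theorem AbsolutelyContinuousOnInterval.le_of_deriv_nonpos_of_lt {ψ : ℝ → ℝ} {a b c : ℝ}
    (hψ : AbsolutelyContinuousOnInterval ψ a b) (h0 : ψ a ≤ c)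
    (hd : ∀ᵐ t, t ∈ Ioo a b → c < ψ t → deriv ψ t ≤ 0) :
    ∀ t ∈ Icc a b, ψ t ≤ c := by
  intro t ht
  by_contra! hlt
  have hab : a ≤ b := ht.1.trans ht.2
  have hcont : ContinuousOn ψ (Icc a t) := by
    have := hψ.continuousOn
    rw [uIcc_of_le hab] at this
    exact this.mono (Icc_subset_Icc_right ht.2)
  have hcl : IsCompact {s ∈ Icc a t | ψ s ≤ c} := by
    have := hcont.preimage_isClosed_of_isClosed isClosed_Icc (isClosed_Iic (a := c))
    exact isCompact_Icc.of_isClosed_subset this inter_subset_left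
  -- `s` is the last time before `t` at which `ψ ≤ c`. On `(s, t]` the function exceeds `c`, so its
  -- derivative is nonpositive almost everywhere there and `ψ t ≤ ψ s ≤ c`.
  obtain ⟨s, ⟨hs, hsc⟩, hmax⟩ :=
    hcl.exists_isMaxOn ⟨a, left_mem_Icc.2 ht.1, h0⟩ continuousOn_id
  have hac : AbsolutelyContinuousOnInterval ψ s t := hψ.mono <| by
    rw [uIcc_of_le hs.2, uIcc_of_le hab]
    exact Icc_subset_Icc hs.1 ht.2
  have hle : ∫ x in s..t, deriv ψ x ≤ 0 := by
    rw [intervalIntegral.integral_of_le hs.2]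
    refine integral_nonpos_of_ae ?_
    rw [Filter.EventuallyLE, ae_restrict_iff' measurableSet_Ioc]
    have hb : ∀ᵐ x : ℝ, x ≠ b := by simp [ae_iff, measure_singleton]
    filter_upwards [hd, hb] with x hx hxb hxs
    refine hx ⟨hs.1.trans_lt hxs.1, lt_of_le_of_ne (hxs.2.trans ht.2) hxb⟩ ?_
    by_contra! hle
    exact absurd (hmax ⟨⟨hs.1.trans hxs.1.le, hxs.2⟩, hle⟩) (not_le.2 hxs.1)
  rw [hac.integral_deriv_eq_sub] at hle
  linarith

end AbsolutelyContinuous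

/-! ### Weak derivatives in one variable -/

section WeakDerivative

variable {F : Type*} [NormedAddCommGroup F] [NormedSpace ℝ F] [CompleteSpace F]

open NonlocalDecay

theorem NonlocalDecay.IsTestFunction.endpoints_eq_zero {a b : ℝ} {φ : ℝ → ℝ} (hφ : IsTestFunction (Ioo a b) φ) :
    φ a = 0 ∧ φ b = 0 :=
  ⟨image_eq_zero_of_notMem_tsupport fun h => lt_irrefl _ (hφ.supp h).1,
    image_eq_zero_of_notMem_tsupport fun h => lt_irrefl _ (hφ.supp h).2⟩

/-- A test function with vanishing integral is the derivative of a test function. -/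
theorem NonlocalDecay.IsTestFunction.exists_deriv_eq {a b : ℝ} {ψ : ℝ → ℝ}
    (hψ : IsTestFunction (Ioo a b) ψ) (h0 : ∫ t, ψ t = 0) :
    ∃ φ, IsTestFunction (Ioo a b) φ ∧ deriv φ = ψ := by
  have hc := hψ.smooth.continuous
  have hder : ∀ x, HasDerivAt (fun x => ∫ t in a..x, ψ t) (ψ x) x := fun x =>
    intervalIntegral.integral_hasDerivAt_right (hc.intervalIntegrable _ _)
      (hc.stronglyMeasurableAtFilter _ _) hc.continuousAt
  have hde : deriv (fun x => ∫ t in a..x, ψ t) = ψ := funext fun x => (hder x).deriv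
  have hsm : ContDiff ℝ ∞ (fun x => ∫ t in a..x, ψ t) :=
    contDiff_infty_iff_deriv.2 ⟨fun x => (hder x).differentiableAt, by rw [hde]; exact hψ.smooth⟩
  -- The primitive from `a` vanishes to the left of the support of `ψ`, and to the right of it
  -- because it equals the full integral there, which is zero.
  obtain ⟨K, hK⟩ : ∃ K : Set ℝ, IsCompact K ∧ K ⊆ Ioo a b ∧
      Function.support (fun x => ∫ t in a..x, ψ t) ⊆ K := by
    rcases (tsupport ψ).eq_empty_or_nonempty with he | hne
    · refine ⟨∅, isCompact_empty, empty_subset _, ?_⟩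
      rw [tsupport_eq_empty_iff.1 he]
      simp
    obtain ⟨p, hp, hpm⟩ := hψ.compact.isCompact.exists_isLeast hne
    obtain ⟨q, hq, hqm⟩ := hψ.compact.isCompact.exists_isGreatest hne
    refine ⟨Icc p q, isCompact_Icc, Icc_subset_Ioo (hψ.supp hp).1 (hψ.supp hq).2, ?_⟩
    have hlow : ∀ x, x < p → ψ x = 0 := fun x hx =>
      image_eq_zero_of_notMem_tsupport fun h => absurd (hpm h) (not_le.2 hx)
    have hup : ∀ x, q < x → ψ x = 0 := fun x hx =>
      image_eq_zero_of_notMem_tsupport fun h => absurd (hqm h) (not_le.2 hx)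
    have hap := (hψ.supp hp).1
    intro x hx
    by_contra hxK
    refine hx ?_
    rw [mem_Icc, not_and_or, not_le, not_le] at hxK
    rcases hxK with h | h
    · refine (intervalIntegral.integral_congr (g := fun _ => 0) fun y hy => ?_).trans (by simp)
      exact hlow y (lt_of_le_of_lt hy.2 (max_lt hap h))
    · change ∫ t in a..x, ψ t = 0
      have hax : a ≤ x := hap.le.trans ((hpm hq).trans h.le)
      rw [intervalIntegral.integral_of_le hax, setIntegral_eq_integral_of_forall_compl_eq_zero, h0]
      intro y hy
      rw [mem_Ioc, not_and_or, not_lt, not_le] at hy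
      rcases hy with hy | hy
      · exact hlow y (hy.trans_lt hap)
      · exact hup y (h.trans hy)
  refine ⟨_, ⟨hsm, HasCompactSupport.of_support_subset_isCompact hK.1 hK.2.2, ?_⟩, hde⟩
  exact (closure_minimal hK.2.2 hK.1.isClosed).trans hK.2.1

/-- Integration by parts of a test function against a primitive. -/
theorem NonlocalDecay.IsTestFunction.integral_deriv_smul_primitive {a b : ℝ} {φ : ℝ → ℝ}
    (hφ : IsTestFunction (Ioo a b) φ) {g : ℝ → F} (hg : IntervalIntegrable g volume a b) :
    ∫ t in a..b, deriv φ t • (∫ s in a..t, g s) = -∫ t in a..b, φ t • g t := by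
  have hac := hg.absolutelyContinuousOnInterval_integral (c := a) left_mem_uIcc
  have hφac : AbsolutelyContinuousOnInterval φ a b :=
    (hφ.smooth.of_le (by simp)).contDiffOn.absolutelyContinuousOnInterval
  have hi1 : IntervalIntegrable (fun t => deriv φ t • (∫ s in a..t, g s)) volume a b :=
    (((hφ.smooth.continuous_deriv (by simp)).continuousOn).smul
      hac.continuousOn).intervalIntegrable
  have hi2 : IntervalIntegrable (fun t => φ t • g t) volume a b :=
    hg.continuousOn_smul hφ.smooth.continuous.continuousOn
  -- The product of `φ` and the primitive vanishes at both endpoints, so its derivative integrates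
  -- to zero.
  have := (hφac.smul hac).integral_eq_sub_of_ae_hasDerivAt
    (f' := fun t => φ t • g t + deriv φ t • (∫ s in a..t, g s)) (by
      filter_upwards [hg.ae_hasDerivAt_integral] with x hx hxm
      exact (hφ.smooth.differentiable (by simp) x).hasDerivAt.smul (hx hxm a left_mem_uIcc))
    (hi2.add hi1)
  rw [intervalIntegral.integral_add hi2 hi1] at this
  simp only [Pi.smul_apply', hφ.endpoints_eq_zero.1, hφ.endpoints_eq_zero.2, zero_smul, sub_zero] at this
  exact eq_neg_of_add_eq_zero_right this

/-- The lemma of du Bois-Reymond: a continuous function with vanishing weak derivative is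
constant. -/
theorem eqOn_const_of_integral_deriv_smul_eq_zero {a b : ℝ} (hab : a < b) {W : ℝ → F}
    (hW : ContinuousOn W (Icc a b))
    (h : ∀ φ : ℝ → ℝ, IsTestFunction (Ioo a b) φ → ∫ t in Ioo a b, deriv φ t • W t = 0) :
    ∃ c, EqOn W (fun _ => c) (Icc a b) := by
  obtain ⟨ρ, hρ, hρ1⟩ : ∃ ρ, IsTestFunction (Ioo a b) ρ ∧ ∫ t, ρ t = 1 := by
    let B : ContDiffBump ((a + b) / 2) := ⟨(b - a) / 8, (b - a) / 4, by linarith, by linarith⟩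
    refine ⟨B.normed volume, ⟨B.contDiff_normed, B.hasCompactSupport_normed, ?_⟩,
      B.integral_normed⟩
    rw [B.tsupport_normed_eq, Real.closedBall_eq_Icc]
    refine Icc_subset_Ioo ?_ ?_ <;> simp only [B] <;> linarith
  have hWint : IntegrableOn W (Ioo a b) :=
    (hW.integrableOn_Icc).mono_set Ioo_subset_Icc_self
  have hint : ∀ φ : ℝ → ℝ, Continuous φ → ∀ V : ℝ → F, ContinuousOn V (Icc a b) →
      IntegrableOn (fun t => φ t • V t) (Ioo a b) := fun φ hφ V hV =>
    (hφ.continuousOn.smul hV).integrableOn_Icc.mono_set Ioo_subset_Icc_self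
  -- Since `ρ` has integral one, the constant value of `W` can only be its `ρ`-average.
  set c : F := ∫ t in Ioo a b, ρ t • W t with hc
  have hset : ∀ φ : ℝ → ℝ, IsTestFunction (Ioo a b) φ → ∀ V : ℝ → F,
      ∫ t in Ioo a b, φ t • V t = ∫ t, φ t • V t := fun φ hφ V =>
    setIntegral_eq_integral_of_forall_compl_eq_zero fun t ht => by
      rw [image_eq_zero_of_notMem_tsupport fun h => ht (hφ.supp h), zero_smul]
  have hae : ∀ᵐ t, t ∈ Ioo a b → W t - c = 0 := by
    refine isOpen_Ioo.ae_eq_zero_of_integral_contDiff_smul_eq_zero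
      (hWint.sub (integrableOn_const (by simp))).locallyIntegrableOn ?_
    intro ψ h1 h2 h3
    have hψ : IsTestFunction (Ioo a b) ψ := ⟨h1, h2, h3⟩
    set m := ∫ t, ψ t with hm
    -- Subtracting `m ρ` removes the mean of `ψ`, so the result is the derivative of a test function
    -- and is annihilated by `W`; this says `∫ ψ (W - c) = 0`.
    have hχ : IsTestFunction (Ioo a b) (fun t => ψ t - m * ρ t) := by
      refine ⟨hψ.smooth.sub (contDiff_const.mul hρ.smooth),
        hψ.compact.sub hρ.compact.mul_left, ?_⟩
      refine (tsupport_sub _ _).trans (union_subset hψ.supp ?_)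
      exact (tsupport_mul_subset_right (f := fun _ => m)).trans hρ.supp
    have hψi := hψ.smooth.continuous.integrable_of_hasCompactSupport (μ := volume) hψ.compact
    have hρi := hρ.smooth.continuous.integrable_of_hasCompactSupport (μ := volume) hρ.compact
    obtain ⟨φ, hφ, hφd⟩ := hχ.exists_deriv_eq (by
      rw [integral_sub hψi (hρi.const_mul m), integral_const_mul, hρ1, mul_one, sub_self])
    have key := h φ hφ
    rw [hφd] at key
    rw [← hset ψ hψ]
    have i1 := hint ψ hψ.smooth.continuous W hW
    have i2 := (hint ρ hρ.smooth.continuous W hW).smul m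
    have e1 : ∫ t in Ioo a b, (ψ t - m * ρ t) • W t = (∫ t in Ioo a b, ψ t • W t) - m • c := by
      rw [hc, ← integral_smul]
      refine Eq.trans ?_ (integral_sub i1 i2)
      simp only [sub_smul, mul_smul]
    have e2 : ∫ t in Ioo a b, ψ t • (W t - c) = (∫ t in Ioo a b, ψ t • W t) - m • c := by
      simp only [smul_sub]
      rw [integral_sub i1 (hint ψ hψ.smooth.continuous _ continuousOn_const), hset ψ hψ (fun _ => c),
        integral_smul_const]
    rw [e2, ← e1, key]
  have hIoo : EqOn W (fun _ => c) (Ioo a b) := by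
    refine Measure.eqOn_Ioo_of_ae_eq (μ := volume) ?_ (hW.mono Ioo_subset_Icc_self)
      continuousOn_const
    rw [Filter.EventuallyEq, ae_restrict_iff' measurableSet_Ioo]
    filter_upwards [hae] with t ht hm using sub_eq_zero.1 (ht hm)
  refine ⟨c, ?_⟩
  refine hIoo.of_subset_closure hW continuousOn_const Ioo_subset_Icc_self ?_
  rw [closure_Ioo hab.ne]

end WeakDerivative
-- The Poincaré inequality and primitives in `L₂(Ω)`
namespace NonlocalDecay

variable {d : ℕ} {Ω : Set (Space d)}

theorem integral_mul_eq_inner (f g : L2 Ω) : ∫ x in Ω, f x * g x = inner ℝ f g := by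
  rw [L2.inner_def]
  exact integral_congr_ae (Filter.Eventually.of_forall fun x => by simp [mul_comm])

theorem integral_sq_eq_norm_sq (f : L2 Ω) : ∫ x in Ω, (f x) ^ 2 = ‖f‖ ^ 2 := by
  rw [← real_inner_self_eq_norm_sq, ← integral_mul_eq_inner]
  simp only [sq]

/-- The Poincaré inequality on `H¹₀(Ω)`. -/
theorem poincareConstant_mul_le {C : ℝ} (hC : C ≤ poincareConstant Ω) (w : H10 Ω) :
    C * ‖H10.val w‖ ^ 2 ≤ ∫ x in Ω, ‖H10.grad w x‖ ^ 2 := by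
  have hnn : ∀ v : H10 Ω, 0 ≤ ∫ x in Ω, ‖H10.grad v x‖ ^ 2 := fun v =>
    integral_nonneg fun x => by positivity
  by_cases hw : H10.val w = 0
  · simpa [hw] using hnn w
  have hpos : 0 < ‖H10.val w‖ ^ 2 := by positivity
  rw [← le_div_iff₀ hpos]
  refine hC.trans (csInf_le ⟨0, ?_⟩ ⟨w, hw, by rw [integral_sq_eq_norm_sq]⟩)
  rintro r ⟨v, -, rfl⟩
  exact div_nonneg (hnn v) (integral_nonneg fun x => by positivity)

/-- A continuous function is the primitive of its weak time derivative. -/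
theorem HasWeakTimeDeriv.eq_add_integral {T : ℝ} (hT : 0 < T) {u u' : ℝ → L2 Ω}
    (h : HasWeakTimeDeriv T u u') (hu : ContinuousOn u (Icc 0 T))
    (hu' : IntervalIntegrable u' volume 0 T) :
    ∀ t ∈ Icc 0 T, u t = u 0 + ∫ s in 0..t, u' s := by
  have hP : ContinuousOn (fun t => ∫ s in 0..t, u' s) (Icc 0 T) := by
    have := (hu'.absolutelyContinuousOnInterval_integral (c := 0) left_mem_uIcc).continuousOn
    rwa [uIcc_of_le hT.le] at this
  have hIoo : ∀ g : ℝ → L2 Ω, ∫ t in Ioo 0 T, g t = ∫ t in 0..T, g t := fun g => by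
    rw [intervalIntegral.integral_of_le hT.le, integral_Ioc_eq_integral_Ioo]
  -- `u` and the primitive of `u'` have the same weak derivative, so their difference is constant.
  obtain ⟨c, hc⟩ := eqOn_const_of_integral_deriv_smul_eq_zero hT (hu.sub hP) (by
    intro φ hφ
    have hφc : ContinuousOn (deriv φ) (Icc 0 T) :=
      (hφ.smooth.continuous_deriv (by simp)).continuousOn
    have hint : ∀ g : ℝ → L2 Ω, ContinuousOn g (Icc 0 T) →
        IntegrableOn (fun t => deriv φ t • g t) (Ioo 0 T) := fun g hg =>
      (hφc.smul hg).integrableOn_Icc.mono_set Ioo_subset_Icc_self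
    simp only [Pi.sub_apply, smul_sub]
    rw [integral_sub (hint u hu) (hint _ hP), h φ hφ, hIoo, hIoo,
      hφ.integral_deriv_smul_primitive hu', sub_self])
  have h0 := hc (left_mem_Icc.2 hT.le)
  intro t ht
  have ht := hc ht
  simp only [Pi.sub_apply, intervalIntegral.integral_same, sub_zero] at h0 ht
  rw [h0, ← ht, sub_add_cancel]

end NonlocalDecay

/-! ### The differential inequality and the decay estimate -/

theorem AbsolutelyContinuousOnInterval.norm_sq {E : Type*} [SeminormedAddCommGroup E]
    {u : ℝ → E} {a b : ℝ}
    (hu : AbsolutelyContinuousOnInterval u a b) :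
    AbsolutelyContinuousOnInterval (fun t => ‖u t‖ ^ 2) a b := by
  have := hu.of_dist_le (f := fun t => ‖u t‖) 1 fun x _ y _ => by
    rw [one_mul, dist_eq_norm, dist_eq_norm]
    exact abs_norm_sub_norm_le _ _
  simpa only [sq] using this.fun_mul this

/-- The differential inequality `y' ≤ -2 C y^{γ+1} + 2 k y^{1/2}` makes `y r^{1/γ}` decrease along
`r = 1 + B t` as soon as it exceeds `y₀`. -/
theorem decay_rate_nonpos {γ C A B y₀ r y k : ℝ} (hγ : 0 < γ) (hC : 0 < C) (hA : 0 ≤ A)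
    (hy₀ : 0 < y₀) (hr : 0 < r) (hB : B = 2 * γ * C * y₀ ^ γ - 2 * γ * A / √y₀)
    (hlt : y₀ < y * r ^ (1 / γ)) (hk : k ≤ A / r ^ ((2 * γ + 1) / (2 * γ))) :
    (-2 * C * y ^ γ * y + 2 * k * √y) * r ^ (1 / γ)
      + y * (B * (1 / γ) * r ^ (1 / γ - 1)) ≤ 0 := by
  set s := r ^ (1 / γ) with hs
  have hs0 : 0 < s := Real.rpow_pos_of_pos hr _
  -- In the rescaled variable `p = y r^(1/γ)` the hypothesis reads `y₀ < p`, and all powers of `r`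
  -- will combine into a common factor `1 / r`.
  obtain ⟨p, rfl⟩ : ∃ p, y = p / s := ⟨y * s, by field_simp⟩
  rw [div_mul_cancel₀ _ hs0.ne'] at hlt
  have hp : 0 < p := hy₀.trans hlt
  have hsγ : s ^ γ = r := by
    rw [hs, ← Real.rpow_mul hr.le, one_div_mul_cancel hγ.ne', Real.rpow_one]
  have hss : √s * √s = s := Real.mul_self_sqrt hs0.le
  have hsq : 0 < √s := Real.sqrt_pos.2 hs0
  have e1 : r ^ (1 / γ - 1) = s / r := by rw [Real.rpow_sub_one hr.ne']
  have e2 : r ^ ((2 * γ + 1) / (2 * γ)) = r * √s := by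
    have : (2 * γ + 1) / (2 * γ) = 1 + 1 / γ * (1 / 2) := by field_simp
    rw [this, Real.rpow_add hr, Real.rpow_one, Real.rpow_mul hr.le, Real.sqrt_eq_rpow]
  rw [e2] at hk
  rw [e1, Real.div_rpow hp.le hs0.le, hsγ, Real.sqrt_div' _ hs0.le]
  have hq : 0 < √y₀ := Real.sqrt_pos.2 hy₀
  have hpq : √y₀ ≤ √p := Real.sqrt_le_sqrt hlt.le
  have hpp : √p * √p = p := Real.mul_self_sqrt hp.le
  have hpγ : y₀ ^ γ ≤ p ^ γ := Real.rpow_le_rpow hy₀.le hlt.le hγ.le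
  have hk' : k * √s ≤ A / r := by
    calc k * √s ≤ A / (r * √s) * √s := by gcongr
      _ = A / r := by field_simp
  calc (-2 * C * (p ^ γ / r) * (p / s) + 2 * k * (√p / √s)) * s
        + p / s * (B * (1 / γ) * (s / r))
      = -2 * C * p ^ γ * p / r + 2 * √p * (k * √s) + p * (B / γ) / r := by
        field_simp
        linear_combination (-2 * r * k * √p * γ) * hss
    _ ≤ -2 * C * p ^ γ * p / r + 2 * √p * (A / r) + p * (B / γ) / r := by gcongr
    -- Inserting `B` pairs each term with its value at `p = y₀`. Both differences are nonpositive
    -- for `p > y₀`; the sign of the second product uses `0 ≤ A`.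
    _ = 2 / r * (C * p * (y₀ ^ γ - p ^ γ) + A * (√p / √y₀) * (√y₀ - √p)) := by
        rw [hB]
        field_simp
        linear_combination A * hpp
    _ ≤ 0 := by
        refine mul_nonpos_of_nonneg_of_nonpos (by positivity) (add_nonpos ?_ ?_)
        · exact mul_nonpos_of_nonneg_of_nonpos (by positivity) (by linarith)
        · exact mul_nonpos_of_nonneg_of_nonpos (by positivity) (by linarith)

theorem mainTheorem6 {d : ℕ} (hd : 1 ≤ d) (Ω : Set (NonlocalDecay.Space d)) (hΩ : IsOpen Ω)
    (hΩb : Bornology.IsBounded Ω) (T : ℝ) (hT : 0 < T) (γ : ℝ) (hγ : 0 < γ)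
    (f : ℝ → NonlocalDecay.L2 Ω) (u₀ : NonlocalDecay.L2 Ω) (hu₀ : u₀ ≠ 0)
    (u : ℝ → NonlocalDecay.L2 Ω) (hu : NonlocalDecay.IsWeakSolution Ω T γ f u₀ u)
    (C₂ : ℝ) (hC₂ : 0 < C₂) (hC₂Ω : C₂ ≤ NonlocalDecay.poincareConstant Ω)
    (A B : ℝ)
    (hA : A < C₂ * (∫ x in Ω, (u₀ x) ^ 2) ^ ((2 * γ + 1) / 2))
    (hB : B = 2 * γ * C₂ * (∫ x in Ω, (u₀ x) ^ 2) ^ γ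
      - 2 * γ * A / (∫ x in Ω, (u₀ x) ^ 2) ^ (1 / 2 : ℝ))
    (hf : ∀ᵐ t ∂(volume.restrict (Ioo 0 T)),
      ‖f t‖ ≤ A / (1 + B * t) ^ ((2 * γ + 1) / (2 * γ))) :
    ∀ t ∈ Icc 0 T,
      ∫ x in Ω, (u t x) ^ 2 ≤ (∫ x in Ω, (u₀ x) ^ 2) / (1 + B * t) ^ (1 / γ) := by
  obtain ⟨hcont, hinit, U, u', -, hUu, hu'2, hweak, heq⟩ := hu
  have hy₀ : 0 < ∫ x in Ω, (u₀ x) ^ 2 := by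
    rw [NonlocalDecay.integral_sq_eq_norm_sq]
    positivity
  set y₀ := ∫ x in Ω, (u₀ x) ^ 2 with hy₀def
  have hq : 0 < √y₀ := Real.sqrt_pos.2 hy₀
  rw [← Real.sqrt_eq_rpow] at hB
  -- After division by `√y₀`, the bound on `A` is exactly `B > 0`; it keeps `1 + B t` positive.
  have hBpos : 0 < B := by
    have hexp : y₀ ^ ((2 * γ + 1) / 2) = y₀ ^ γ * √y₀ := by
      rw [Real.sqrt_eq_rpow, ← Real.rpow_add hy₀]
      congr 1
      ring
    rw [hexp, ← mul_assoc, ← div_lt_iff₀ hq] at hA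
    have : B = 2 * γ * (C₂ * y₀ ^ γ - A / √y₀) := by rw [hB]; ring
    rw [this]
    exact mul_pos (by positivity) (sub_pos.2 hA)
  have hr : ∀ t, 0 ≤ t → 0 < 1 + B * t := fun t ht => by positivity
  -- The bound on `‖f t‖` holds at some `t` in the interval, and a norm is nonnegative.
  have hA0 : 0 ≤ A := by
    have hne : (ae (volume.restrict (Ioo 0 T))).NeBot := by
      rw [ae_neBot, Ne, Measure.restrict_eq_zero]
      simp [hT]
    obtain ⟨t, ht, htm⟩ := (hf.and (ae_restrict_mem measurableSet_Ioo)).exists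
    have hpos := Real.rpow_pos_of_pos (hr t htm.1.le) ((2 * γ + 1) / (2 * γ))
    simpa using (le_div_iff₀ hpos).1 ((norm_nonneg _).trans ht)
  have hu'i : IntervalIntegrable u' volume 0 T := by
    rw [intervalIntegrable_iff_integrableOn_Ioo_of_le hT.le]
    exact hu'2.integrable (by norm_num)
  have hrep := hweak.eq_add_integral hT hcont hu'i
  have hac : AbsolutelyContinuousOnInterval u 0 T :=
    (hu'i.absolutelyContinuousOnInterval_integral left_mem_uIcc).of_dist_le 1 fun x hx y hy => by
      rw [uIcc_of_le hT.le] at hx hy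
      rw [hrep x hx, hrep y hy, dist_add_left, one_mul]
  have hder : ∀ᵐ t, t ∈ Ioo 0 T → HasDerivAt u (u' t) t := by
    filter_upwards [hu'i.ae_hasDerivAt_integral] with t ht htm
    have htc : t ∈ uIcc 0 T := by
      rw [uIcc_of_le hT.le]
      exact Ioo_subset_Icc_self htm
    refine ((ht htc 0 left_mem_uIcc).const_add (u 0)).congr_of_eventuallyEq ?_
    filter_upwards [isOpen_Ioo.mem_nhds htm] with s hs using hrep s (Ioo_subset_Icc_self hs)
  have hrd : ∀ t ∈ Icc 0 T, ContDiffAt ℝ 1 (fun t => (1 + B * t) ^ (1 / γ)) t := fun t ht =>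
    (contDiffAt_const.add (contDiffAt_const.mul contDiffAt_id)).rpow_const_of_ne
      (hr t ht.1).ne'
  have hrac : AbsolutelyContinuousOnInterval (fun t => (1 + B * t) ^ (1 / γ)) 0 T := by
    refine ContDiffOn.absolutelyContinuousOnInterval fun t ht => ?_
    rw [uIcc_of_le hT.le] at ht
    exact (hrd t ht).contDiffWithinAt
  have hψ := (hac.norm_sq.fun_mul hrac).le_of_deriv_nonpos_of_lt (c := y₀)
    (by simp [hinit, hy₀def, NonlocalDecay.integral_sq_eq_norm_sq]) (by
      filter_upwards [hder, (ae_restrict_iff' measurableSet_Ioo).1 hf,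
        (ae_restrict_iff' measurableSet_Ioo).1 hUu,
        (ae_restrict_iff' measurableSet_Ioo).1 heq] with t h1 h2 h3 h4 ht hlt
      have hrt := hr t ht.1.le
      have hr' : HasDerivAt (fun t => (1 + B * t) ^ (1 / γ))
          (B * (1 / γ) * (1 + B * t) ^ (1 / γ - 1)) t := by
        have : HasDerivAt (fun t => 1 + B * t) B t := by
          simpa using ((hasDerivAt_id t).const_mul B).const_add 1
        exact this.rpow_const (Or.inl hrt.ne')
      rw [((h1 ht).norm_sq.fun_mul hr').deriv]
      -- Taking `y = ‖u t‖²` and `k = ‖f t‖`, what remains is the energy inequality for `2 (u,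
      -- u_t)`.
      refine le_trans ?_ (decay_rate_nonpos hγ hC₂ hA0 hy₀ hrt hB hlt (h2 ht))
      gcongr
      -- The solution itself is an admissible test function at almost every time.
      have hen := h4 ht (U t)
      simp only [real_inner_self_eq_norm_sq] at hen
      rw [NonlocalDecay.integral_mul_eq_inner, NonlocalDecay.integral_mul_eq_inner, h3 ht,
        NonlocalDecay.integral_sq_eq_norm_sq] at hen
      have hpo := NonlocalDecay.poincareConstant_mul_le hC₂Ω (U t)
      rw [h3 ht] at hpo
      have hpo' := mul_le_mul_of_nonneg_left hpo
        (Real.rpow_nonneg (sq_nonneg ‖u t‖) γ)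
      have hcs := real_inner_le_norm (f t) (u t)
      rw [Real.sqrt_sq (norm_nonneg _), real_inner_comm]
      linarith)
  intro t ht
  rw [NonlocalDecay.integral_sq_eq_norm_sq, le_div_iff₀ (Real.rpow_pos_of_pos (hr t ht.1) _)]
  exact hψ t ht
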